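/- Let $d\ge 1$ and $T\ge 0$ be integers. Consider a (possibly adaptive) single-copy algorithm that receives $T$ copies of an unknown state $\rho$ on $\mathbb{C}^d\otimes\mathbb{C}^d$. In each round $t=1,\dots,T$ it measures a fresh copy of $\rho$ with a POVM $\{E_k\}_k$ on $\mathbb{C}^d\otimes\mathbb{C}^d$ (countably many operators $E_k\ge 0$ with $\sum_k E_k=\mathbb{I}$) which may depend on all previous outcomes, sees outcome $k$ with probability $\mathrm{tr}(\rho E_k)$, and discards the post-measurement state. After $T$ rounds it accepts or rejects, possibly at random, on the basis of the outcome string $\ell$. Let $P_A(\rho)$ be the probability that the algorithm $A$ accepts on $T$ copies of $\rho$. Let $\rho_{mm}=\mathbb{I}/d^2$ be the maximally mixed state, and let $|v\rangle=V|0\rangle$ and $|w\rangle=W|0\rangle$ with $V,W$ independent Haar random unitaries on $\mathbb{C}^d$ and $|0\rangle$ the first basis vector. Define the bias of $A$ by $$b(A)=\Bigl|\,\mathbb{E}_{v,w}\,P_A\bigl(|v\rangle\langle v|\otimes|w\rangle\langle w|\bigr)-P_A(\rho_{mm})\Bigr| ,$$ and its success probability, under a uniform prior on the two hypotheses (accepting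 is the correct answer for the random product state), by $$p_{\rm succ}(A)=\tfrac12\,\mathbb{E}_{v,w}\,P_A\bigl(|v\rangle\langle v|\otimes|w\rangle\langle w|\bigr)+\tfrac12\bigl(1-P_A(\rho_{mm})\bigr).$$ There are absolute constants $C,c>0$ such that, for all $d\ge 1$, all $T\ge 0$ and every such algorithm $A$: 1. $b(A)\le C\,T^2/d$, that is, the bias is $O(T^2/d)$; 2. if $p_{\rm succ}(A)\ge 2/3$, then $T\ge c\sqrt d$, that is, distinguishing a Haar random bipartite product state from the maximally mixed state with probability at least $2/3$ requires $\Omega(\sqrt d)$ copies. -/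

import Mathlib

open MeasureTheory
open scoped Kronecker ComplexOrder

namespace SingleCopy

/-- A positive operator-valued measure on the Hilbert space `ℂ^ι`, with outcomes labelled by `K`:
positive semidefinite operators `E k` with `∑ k, E k = I`. -/
structure POVM (K ι : Type*) [Fintype ι] [DecidableEq ι] where
  /-- the operator attached to an outcome -/
  E : K → Matrix ι ι ℂ
  posSemidef : ∀ k, (E k).PosSemidef
  hasSum_one : HasSum E 1

/-- Born rule: the probability `tr (ρ E_k)` of outcome `k` when the state `ρ` is measured. -/
noncomputable def POVM.prob {K ι : Type*} [Fintype ι] [DecidableEq ι]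
    (M : POVM K ι) (ρ : Matrix ι ι ℂ) (k : K) : ℝ :=
  (Matrix.trace (ρ * M.E k)).re

/-- An adaptive single-copy algorithm using `T` copies of a state on `ℂ^ι`. In each round a fresh
copy is measured by a POVM on `ℂ^ι` which may depend on all earlier outcomes, and the
post-measurement state is discarded. After `T` rounds the algorithm looks at the string of outcomes
and accepts with some probability (a value in `{0, 1}` being a deterministic decision). -/
structure Algorithm (K ι : Type*) [Fintype ι] [DecidableEq ι] (T : ℕ) where
  /-- the POVM applied in round `t`, given the outcomes of the rounds before `t` -/
  povm : (t : Fin T) → (Fin t → K) → POVM K ι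
  /-- the probability of accepting, given the whole outcome string -/
  accept : (Fin T → K) → ℝ
  accept_mem : ∀ l, accept l ∈ Set.Icc (0 : ℝ) 1

namespace Algorithm

variable {K ι : Type*} [Fintype ι] [DecidableEq ι] {T : ℕ}

/-- The probability `p^ρ(l)` of seeing the outcome string `l = s_1 ⋯ s_T` when every copy is in
the state `ρ`. -/
noncomputable def outcomeProb (A : Algorithm K ι T) (ρ : Matrix ι ι ℂ) (l : Fin T → K) : ℝ :=
  ∏ t : Fin T, (A.povm t fun i => l (Fin.castLE t.isLt.le i)).prob ρ (l t)

/-- The probability that the algorithm accepts when given `T` copies of `ρ`. -/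
noncomputable def acceptProb (A : Algorithm K ι T) (ρ : Matrix ι ι ℂ) : ℝ :=
  ∑' l : Fin T → K, A.outcomeProb ρ l * A.accept l

end Algorithm

/-- The unitary group of `ℂ^d` is compact. -/
instance instCompactSpaceUnitary (d : ℕ) : CompactSpace (Matrix.unitaryGroup (Fin d) ℂ) := by
  refine isCompact_iff_compactSpace.mp ?_
  have hK : IsCompact (Set.univ.pi fun _ : Fin d => Set.univ.pi fun _ : Fin d =>
      Metric.closedBall (0 : ℂ) 1) :=
    isCompact_univ_pi fun _ => isCompact_univ_pi fun _ => isCompact_closedBall _ _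
  refine hK.of_isClosed_subset
    (isClosed_unitary (R := Matrix (Fin d) (Fin d) ℂ)) fun U hU i _ j _ => ?_
  simpa using entry_norm_bound_of_unitary hU i j

noncomputable instance instMeasurableSpaceUnitary (d : ℕ) : MeasurableSpace (Matrix.unitaryGroup (Fin d) ℂ) :=
  borel _

instance instBorelSpaceUnitary (d : ℕ) : BorelSpace (Matrix.unitaryGroup (Fin d) ℂ) := ⟨rfl⟩

/-- The Haar probability measure on the unitary group of `ℂ^d`. -/
noncomputable def haarUnitary (d : ℕ) : Measure (Matrix.unitaryGroup (Fin d) ℂ) :=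
  Measure.haarMeasure ⊤

/-- The pure state `U |0⟩⟨0| U†` on `ℂ^d`. -/
def pureState {d : ℕ} [NeZero d] (U : Matrix.unitaryGroup (Fin d) ℂ) : Matrix (Fin d) (Fin d) ℂ :=
  (U : Matrix (Fin d) (Fin d) ℂ) * Matrix.single 0 0 1 * star (U : Matrix (Fin d) (Fin d) ℂ)

/-- The maximally mixed state `I / d²` on `ℂ^d ⊗ ℂ^d`. -/
noncomputable def maxMixed (d : ℕ) : Matrix (Fin d × Fin d) (Fin d × Fin d) ℂ :=
  ((d : ℂ) ^ 2)⁻¹ • 1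

namespace Algorithm

variable {K : Type*} {d T : ℕ}

/-- The probability that the algorithm accepts `T` copies of a random product state
`|v⟩⟨v| ⊗ |w⟩⟨w|`, where `v` and `w` are independent Haar random pure states of `ℂ^d`. -/
noncomputable def acceptProbProduct [NeZero d] (A : Algorithm K (Fin d × Fin d) T) : ℝ :=
  ∫ VW, A.acceptProb (pureState VW.1 ⊗ₖ pureState VW.2) ∂((haarUnitary d).prod (haarUnitary d))

/-- The bias: the difference between the acceptance probabilities of the two hypotheses. -/
noncomputable def bias [NeZero d] (A : Algorithm K (Fin d × Fin d) T) : ℝ :=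
  |A.acceptProbProduct - A.acceptProb (maxMixed d)|

/-- The probability of naming the right hypothesis, when the unknown state is a random product state
(accepting is right) or the maximally mixed state (rejecting is right) with probability `1/2`
each. -/
noncomputable def successProb [NeZero d] (A : Algorithm K (Fin d × Fin d) T) : ℝ :=
  1 / 2 * A.acceptProbProduct + 1 / 2 * (1 - A.acceptProb (maxMixed d))

end Algorithm

end SingleCopy

namespace SingleCopy

/-! Post-measurement states are discarded, so an outcome string has probability `∏ t, tr (ρ E_t)`,
and the `E_t` along a fixed string do not depend on `ρ`. It is enough to compare the two hypotheses
string by string, and only from one side: if `p ≥ (1 - ε) q` pointwise for two probability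
distributions, acceptance probabilities differ by at most `ε`.

The pointwise bound rests on `E_v ∏ t, |ψ_t · v|² ≥ ∏ t, ‖ψ_t‖² / (d (d+1) ⋯ (d+T-1))` for a Haar
random unit vector `v`, in essence the inequality that the permanent of a Gram matrix is at least
the product of its diagonal entries. It follows by adding one factor at a time: for `h` homogeneous
of degree `n`, `E |φ · v|² |h(v)|² ≥ ‖φ‖² E |h(v)|² / (d + n)`. Unitary invariance turns `φ` into a
multiple of a coordinate functional; monomials are orthogonal, so only the ratio of consecutive
monomial moments is needed (`integral_monomial_add_single`).

Splitting each `E_t` into rank-one terms and applying this first to `w`, then to `v`, gives the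
ratio `(∏ t, d / (d + t))² ≥ 1 - T² / d`. -/

instance instIsProbabilityMeasureHaarUnitary (d : ℕ) : IsProbabilityMeasure (haarUnitary d) :=
  ⟨Measure.haarMeasure_self⟩

instance instIsMulLeftInvariantHaarUnitary (d : ℕ) : (haarUnitary d).IsMulLeftInvariant := by
  unfold haarUnitary; infer_instance

/-! ### Haar random unit vectors: invariance, orthogonality and moments of monomials. -/

section FirstColumn

variable {d : ℕ} [NeZero d]

/-- The first column `U |0⟩` of a unitary matrix. -/
def firstColumn (U : Matrix.unitaryGroup (Fin d) ℂ) : Fin d → ℂ := fun a => (U : Matrix (Fin d) (Fin d) ℂ) a 0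

lemma continuous_firstColumn : Continuous (firstColumn (d := d)) :=
  continuous_pi fun a => continuous_subtype_val.matrix_elem a 0

lemma firstColumn_mul (W U : Matrix.unitaryGroup (Fin d) ℂ) :
    firstColumn (W * U) = (W : Matrix (Fin d) (Fin d) ℂ).mulVec (firstColumn U) := by
  ext a
  simp [firstColumn, Matrix.mul_apply, Matrix.mulVec, dotProduct]

lemma sum_norm_sq_firstColumn (U : Matrix.unitaryGroup (Fin d) ℂ) :
    ∑ a, ‖firstColumn U a‖ ^ 2 = 1 := by
  have h := congrFun (congrFun (Matrix.mem_unitaryGroup_iff'.mp U.2) 0) 0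
  simp only [Matrix.mul_apply, Matrix.star_apply, Matrix.one_apply_eq] at h
  have h2 : ((∑ a, ‖firstColumn U a‖ ^ 2 : ℝ) : ℂ) = 1 := by
    rw [← h]; push_cast
    refine Finset.sum_congr rfl fun a _ => ?_
    rw [← Complex.conj_mul']; rfl
  exact_mod_cast h2

lemma integrable_comp_firstColumn {E : Type*} [NormedAddCommGroup E] {F : (Fin d → ℂ) → E}
    (hF : Continuous F) : Integrable (fun U => F (firstColumn U)) (haarUnitary d) :=
  (hF.comp continuous_firstColumn).integrable_of_hasCompactSupport
    (HasCompactSupport.of_compactSpace _)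

lemma integral_comp_mulVec_firstColumn {E : Type*} [NormedAddCommGroup E] [NormedSpace ℝ E]
    (F : (Fin d → ℂ) → E) (W : Matrix.unitaryGroup (Fin d) ℂ) :
    ∫ U, F ((W : Matrix (Fin d) (Fin d) ℂ).mulVec (firstColumn U)) ∂haarUnitary d
      = ∫ U, F (firstColumn U) ∂haarUnitary d := by
  simp_rw [← firstColumn_mul]
  exact integral_mul_left_eq_self (fun U => F (firstColumn U)) W

/-- Every vector is a multiple of the first row of some unitary matrix. -/
lemma exists_unitary_row (φ : Fin d → ℂ) :
    ∃ W : Matrix.unitaryGroup (Fin d) ℂ, ∀ v : Fin d → ℂ,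
      ∑ a, φ a * v a = (√(∑ a, ‖φ a‖ ^ 2) : ℂ) * (W : Matrix (Fin d) (Fin d) ℂ).mulVec v 0 := by
  set r : ℝ := √(∑ a, ‖φ a‖ ^ 2) with hr
  by_cases h0 : r = 0
  · refine ⟨1, fun v => ?_⟩
    have h1 : ∑ a, ‖φ a‖ ^ 2 = 0 :=
      (Real.sqrt_eq_zero (Finset.sum_nonneg fun _ _ => by positivity)).mp h0
    rw [Finset.sum_eq_zero_iff_of_nonneg (fun _ _ => by positivity)] at h1
    simp only [h0, Complex.ofReal_zero, zero_mul]
    refine Finset.sum_eq_zero fun a ha => ?_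
    have := h1 a ha
    simp at this
    simp [this]
  -- The conjugate is taken because the first row of the change-of-basis matrix has entries `⟪u,
  -- e_a⟫`, which conjugates `u` back to `φ a / r`.
  · set u : EuclideanSpace ℂ (Fin d) := WithLp.toLp 2 fun a => star (φ a) / r with hu
    have hun : ‖u‖ = 1 := by
      rw [EuclideanSpace.norm_eq, hu]
      simp only [norm_div, norm_star, Complex.norm_real, div_pow, ← Finset.sum_div]
      rw [Real.sqrt_div (Finset.sum_nonneg fun _ _ => by positivity), ← hr]
      simp [abs_of_nonneg (Real.sqrt_nonneg (∑ a, ‖φ a‖ ^ 2)), hr]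
      rwa [hr] at h0
    obtain ⟨b, hb⟩ := Orthonormal.exists_orthonormalBasis_extension_of_card_eq (𝕜 := ℂ)
      (E := EuclideanSpace ℂ (Fin d)) (ι := Fin d) (by simp) (v := fun _ => u) (s := {0})
      ⟨fun _ => by simpa [Set.domRestrict] using hun, fun i j hij => absurd (Subsingleton.elim i j) hij⟩
    have hb0 : b 0 = u := hb 0 rfl
    refine ⟨⟨_, b.toMatrix_orthonormalBasis_mem_unitary (EuclideanSpace.basisFun (Fin d) ℂ)⟩,
      fun v => ?_⟩
    simp only [Matrix.mulVec, dotProduct, Finset.mul_sum]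
    refine Finset.sum_congr rfl fun a _ => ?_
    have hr' : (r : ℂ) ≠ 0 := by exact_mod_cast h0
    have : b.toBasis.toMatrix (⇑(EuclideanSpace.basisFun (Fin d) ℂ)) 0 a = φ a / r := by
      rw [Module.Basis.toMatrix_apply]
      simp only [OrthonormalBasis.coe_toBasis_repr_apply, OrthonormalBasis.repr_apply_apply, hb0]
      simp [hu, EuclideanSpace.inner_single_right]
    rw [this]; field_simp

/-- The average of `|φ · v|^{2n}` over Haar random `v` depends on the norm of `φ` only. -/
lemma integral_norm_linear_pow (φ : Fin d → ℂ) (n : ℕ) :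
    ∫ U, ‖∑ a, φ a * firstColumn U a‖ ^ (2 * n) ∂haarUnitary d
      = (∑ a, ‖φ a‖ ^ 2) ^ n * ∫ U, ‖firstColumn U 0‖ ^ (2 * n) ∂haarUnitary d := by
  obtain ⟨W, hW⟩ := exists_unitary_row φ
  simp_rw [hW, norm_mul, mul_pow]
  rw [integral_const_mul, integral_comp_mulVec_firstColumn (fun v => ‖v 0‖ ^ (2 * n)),
    Complex.norm_real, Real.norm_of_nonneg (Real.sqrt_nonneg _), pow_mul, Real.sq_sqrt
    (Finset.sum_nonneg fun _ _ => by positivity)]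

/-- Distinct monomials are orthogonal. -/
lemma integral_monomial_mul_conj {α β : Fin d → ℕ} (h : α ≠ β) :
    ∫ U, (∏ i, firstColumn U i ^ α i) * star (∏ i, firstColumn U i ^ β i) ∂haarUnitary d = 0 := by
  obtain ⟨i, hi⟩ := Function.ne_iff.mp h
  set F : (Fin d → ℂ) → ℂ := fun v => (∏ i, v i ^ α i) * star (∏ i, v i ^ β i) with hF
  -- Rotating coordinate `i` by a phase `ω` preserves the integral but multiplies the integrand by
  -- `ω ^ α i * star ω ^ β i`. The angle `π / (α i - β i)` makes this factor `-1`.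
  obtain ⟨ω, hω1, hω⟩ : ∃ ω : ℂ, ω * star ω = 1 ∧ ω ^ α i * star ω ^ β i ≠ 1 := by
    have hi' : ((α i : ℝ) - β i) ≠ 0 := sub_ne_zero.mpr (by exact_mod_cast hi)
    set t : ℝ := Real.pi / (α i - β i) with ht
    have hs : star (Complex.exp (t * Complex.I)) = Complex.exp (-(t * Complex.I)) := by
      rw [Complex.star_def, ← Complex.exp_conj]; simp
    refine ⟨Complex.exp (t * Complex.I), ?_, ?_⟩
    · rw [hs, ← Complex.exp_add]; simp
    · rw [hs, ← Complex.exp_nat_mul, ← Complex.exp_nat_mul, ← Complex.exp_add]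
      have : (α i : ℂ) * (t * Complex.I) + β i * -(t * Complex.I) = Real.pi * Complex.I := by
        have h3 : t * (α i - β i) = Real.pi := by rw [ht]; field_simp
        rw [← h3]; push_cast; ring
      rw [this, Complex.exp_pi_mul_I]; norm_num
  set D : Fin d → ℂ := Function.update 1 i ω with hD
  have hU : Matrix.diagonal D ∈ Matrix.unitaryGroup (Fin d) ℂ := by
    rw [Matrix.mem_unitaryGroup_iff, Matrix.star_eq_conjTranspose, Matrix.diagonal_conjTranspose,
      Matrix.diagonal_mul_diagonal, ← Matrix.diagonal_one]
    congr 1; ext j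
    by_cases hj : j = i
    · subst hj; simpa [hD] using hω1
    · simp [hD, hj]
  have hp : ∀ (γ : Fin d → ℕ) (v : Fin d → ℂ),
      ∏ j, (Matrix.diagonal D).mulVec v j ^ γ j = ω ^ γ i * ∏ j, v j ^ γ j := by
    intro γ v
    simp_rw [Matrix.mulVec_diagonal, mul_pow, Finset.prod_mul_distrib]
    congr 1
    rw [Finset.prod_eq_single i (fun j _ hj => by simp [hD, hj]) (by simp)]
    simp [hD]
  have key := integral_comp_mulVec_firstColumn F ⟨_, hU⟩
  have hFD : ∀ v, F ((Matrix.diagonal D).mulVec v) = (ω ^ α i * star ω ^ β i) * F v := by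
    intro v; simp only [hF, hp, star_mul, star_pow]; ring
  simp_rw [hFD] at key
  rw [integral_const_mul] at key
  by_contra hne
  exact hω (mul_right_cancel₀ hne (key.trans (one_mul _).symm))

/-- Pythagoras for orthogonal monomials. The exponents are a general injective family so that the
result also covers a polynomial multiplied by a coordinate, whose exponents are shifted. -/
lemma integral_norm_sum_monomial_sq {κ : Type*} (s : Finset κ) (e : κ → Fin d → ℕ)
    (he : Set.InjOn e s) (c : κ → ℂ) :
    ∫ U, ‖∑ k ∈ s, c k * ∏ i, firstColumn U i ^ e k i‖ ^ 2 ∂haarUnitary d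
      = ∑ k ∈ s, ‖c k‖ ^ 2 * ∫ U, ‖∏ i, firstColumn U i ^ e k i‖ ^ 2 ∂haarUnitary d := by
  have hnorm : ∀ x : ℂ, ((‖x‖ ^ 2 : ℝ) : ℂ) = x * star x := fun x => by
    rw [Complex.star_def, Complex.mul_conj']; push_cast; rfl
  have hc : ∀ (k l : κ), Continuous fun v : Fin d → ℂ =>
      (c k * star (c l)) * ((∏ i, v i ^ e k i) * star (∏ i, v i ^ e l i)) := fun k l => by fun_prop
  apply Complex.ofReal_injective
  rw [← integral_complex_ofReal]
  simp_rw [hnorm, star_sum, Finset.sum_mul_sum]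
  have hre : ∀ (U : Matrix.unitaryGroup (Fin d) ℂ) (k l : κ),
      c k * (∏ i, firstColumn U i ^ e k i) * star (c l * ∏ i, firstColumn U i ^ e l i)
      = (c k * star (c l)) *
        ((∏ i, firstColumn U i ^ e k i) * star (∏ i, firstColumn U i ^ e l i)) := by
    intro U k l; rw [star_mul]; ring
  simp_rw [hre]
  rw [integral_finsetSum _ fun k _ => integrable_finsetSum _ fun l _ =>
    integrable_comp_firstColumn (hc k l)]
  push_cast
  refine Finset.sum_congr rfl fun k hk => ?_
  rw [integral_finsetSum _ fun l _ => integrable_comp_firstColumn (hc k l),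
    Finset.sum_eq_single k]
  · rw [integral_const_mul, ← integral_complex_ofReal, ← hnorm]
    simp_rw [← hnorm]; push_cast; rfl
  · intro l hl hlk
    rw [integral_const_mul, integral_monomial_mul_conj fun h => hlk (he hl hk h.symm), mul_zero]
  · exact fun h => absurd hk h

/-- The second moment of a monomial, up to a factor that depends on the degree only. -/
lemma multinomial_mul_integral_monomial (n : ℕ) {α : Fin d → ℕ} (hα : ∑ i, α i = n) :
    (Nat.multinomial Finset.univ α : ℝ)
        * ∫ U, ‖∏ i, firstColumn U i ^ α i‖ ^ 2 ∂haarUnitary d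
      = ∫ U, ‖firstColumn U 0‖ ^ (2 * n) ∂haarUnitary d := by
  set M := ∫ U, ‖firstColumn U 0‖ ^ (2 * n) ∂haarUnitary d
  set y : (Fin d → ℕ) → ℝ := fun k => ∫ U, ‖∏ i, firstColumn U i ^ k i‖ ^ 2 ∂haarUnitary d with hy
  set S := Finset.piAntidiag (Finset.univ : Finset (Fin d)) n
  set m : (Fin d → ℕ) → ℝ := fun k => (Nat.multinomial Finset.univ k : ℝ)
  -- With `φ a = √(x a)`, both sides of `integral_norm_linear_pow` become polynomials in `x`: the
  -- left by the multinomial theorem and orthogonality, the right by the multinomial theorem for `(∑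
  -- a, x a) ^ n`.
  have hx : ∀ x : Fin d → ℝ, (∀ i, 0 ≤ x i) →
      ∑ k ∈ S, m k ^ 2 * y k * ∏ i, x i ^ k i = ∑ k ∈ S, m k * M * ∏ i, x i ^ k i := by
    intro x hx
    have h1 := integral_norm_linear_pow (fun a => ((√(x a) : ℝ) : ℂ)) n
    have h2 : ∀ a, ‖((√(x a) : ℝ) : ℂ)‖ ^ 2 = x a := fun a => by
      rw [Complex.norm_real, Real.norm_of_nonneg (Real.sqrt_nonneg _), Real.sq_sqrt (hx a)]
    simp_rw [h2] at h1
    have h3 : ∀ U : Matrix.unitaryGroup (Fin d) ℂ,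
        ‖∑ a, ((√(x a) : ℝ) : ℂ) * firstColumn U a‖ ^ (2 * n)
        = ‖∑ k ∈ S, ((m k : ℂ) * ∏ i, ((√(x i) : ℝ) : ℂ) ^ k i)
            * ∏ i, firstColumn U i ^ k i‖ ^ 2 := by
      intro U
      rw [mul_comm, pow_mul, ← norm_pow, Finset.sum_pow_eq_sum_piAntidiag]
      congr 2
      refine Finset.sum_congr rfl fun k _ => ?_
      simp_rw [mul_pow, Finset.prod_mul_distrib]
      simp [m, mul_assoc]
    simp_rw [h3] at h1
    rw [integral_norm_sum_monomial_sq S (fun k => k) (fun _ _ _ _ h => h),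
      Finset.sum_pow_eq_sum_piAntidiag, Finset.sum_mul] at h1
    convert h1 using 1
    · refine Finset.sum_congr rfl fun k _ => ?_
      rw [norm_mul, norm_prod, mul_pow, ← Finset.prod_pow]
      simp_rw [norm_pow, ← pow_mul, mul_comm _ 2, pow_mul, h2]
      simp [m, hy]; ring
    · refine Finset.sum_congr rfl fun k _ => ?_
      simp [m]; ring
  -- Agreement on the nonnegative orthant, a product of infinite sets, forces equality of
  -- polynomials; the moment is then read off from the coefficient at `α`.
  have hP : ∑ k ∈ S, MvPolynomial.monomial (Finsupp.equivFunOnFinite.symm k) (m k ^ 2 * y k)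
      = ∑ k ∈ S, MvPolynomial.monomial (Finsupp.equivFunOnFinite.symm k) (m k * M) := by
    refine MvPolynomial.funext_set (fun _ => Set.Ici (0 : ℝ)) (fun _ => Set.Ici_infinite 0) ?_
    intro x hx0
    have := hx x fun i => hx0 i (Set.mem_univ i)
    simpa [map_sum, MvPolynomial.eval_monomial, Finsupp.prod_fintype] using this
  have hmem : α ∈ S := by simp [S, Finset.mem_piAntidiag, hα]
  have hc := congrArg (MvPolynomial.coeff (Finsupp.equivFunOnFinite.symm α)) hP
  simp only [MvPolynomial.coeff_sum, MvPolynomial.coeff_monomial,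
    EmbeddingLike.apply_eq_iff_eq, Finset.sum_ite_eq', hmem, if_true] at hc
  have hm : m α ≠ 0 := by
    simpa [m] using (Nat.multinomial_pos Finset.univ α).ne'
  apply mul_left_cancel₀ hm
  rw [← hc]; simp only [m, hy]; ring

end FirstColumn

/-! ### Lower bounds for moments of products of linear forms. -/

section Moments

variable {d : ℕ} [NeZero d]

lemma prod_pow_add_single {d : ℕ} (z : Fin d → ℂ) (α : Fin d → ℕ) (i : Fin d) :
    ∏ j, z j ^ (α + Pi.single i 1 : Fin d → ℕ) j = z i * ∏ j, z j ^ α j := by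
  simp_rw [Pi.add_apply, pow_add, Finset.prod_mul_distrib]
  rw [mul_comm]
  congr 1
  rw [Finset.prod_eq_single i (fun j _ hj => by simp [hj]) (by simp)]
  simp

lemma multinomial_add_single {d : ℕ} (α : Fin d → ℕ) (i : Fin d) :
    (α i + 1) * Nat.multinomial Finset.univ (α + Pi.single i 1)
      = (∑ j, α j + 1) * Nat.multinomial Finset.univ α := by
  have h1 := Nat.multinomial_spec Finset.univ α
  have h2 := Nat.multinomial_spec Finset.univ (α + Pi.single i 1)
  have h3 : ∑ j, (α + Pi.single i 1 : Fin d → ℕ) j = ∑ j, α j + 1 := by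
    simp [Finset.sum_add_distrib]
  have h4 : ∏ j, ((α + Pi.single i 1 : Fin d → ℕ) j).factorial = (α i + 1) * ∏ j, (α j).factorial := by
    rw [← Finset.mul_prod_erase _ _ (Finset.mem_univ i),
      ← Finset.mul_prod_erase _ (fun j => (α j).factorial) (Finset.mem_univ i), ← mul_assoc]
    congr 1
    · simp [Nat.factorial_succ]
    · refine Finset.prod_congr rfl fun j hj => ?_
      simp [Finset.ne_of_mem_erase hj]
  rw [h3, h4, Nat.factorial_succ, ← h1] at h2
  have hP : 0 < ∏ j, (α j).factorial := Finset.prod_pos fun j _ => Nat.factorial_pos _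
  apply Nat.eq_of_mul_eq_mul_left hP
  linarith

/-- In degree `n + 1` every moment is the same constant over a multinomial coefficient, so the
moments at `α + Pi.single j 1` are proportional to `α j + 1`. Inserting `∑ j, |v j|² = 1` shows that
they sum to the moment at `α`, and the weights `α j + 1` sum to `d + n`. -/
lemma integral_monomial_add_single {n : ℕ} {α : Fin d → ℕ} (hα : ∑ i, α i = n) (i : Fin d) :
    (d + n : ℝ) * ∫ U, ‖∏ j, firstColumn U j ^ (α + Pi.single i 1 : Fin d → ℕ) j‖ ^ 2 ∂haarUnitary d
      = (α i + 1) * ∫ U, ‖∏ j, firstColumn U j ^ α j‖ ^ 2 ∂haarUnitary d := by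
  set y : (Fin d → ℕ) → ℝ := fun k => ∫ U, ‖∏ i, firstColumn U i ^ k i‖ ^ 2 ∂haarUnitary d with hy
  change (d + n : ℝ) * y (α + Pi.single i 1) = (α i + 1) * y α
  set M := ∫ U, ‖firstColumn U 0‖ ^ (2 * (n + 1)) ∂haarUnitary d
  have hm : 0 < (Nat.multinomial Finset.univ α : ℝ) := by
    exact_mod_cast Nat.multinomial_pos Finset.univ α
  have key : ∀ j, ((n : ℝ) + 1) * Nat.multinomial Finset.univ α * y (α + Pi.single j 1)
      = (α j + 1) * M := by
    intro j
    have h1 : (α j + 1 : ℝ) * Nat.multinomial Finset.univ (α + Pi.single j 1)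
        = ((n : ℝ) + 1) * Nat.multinomial Finset.univ α := by
      have := multinomial_add_single α j
      rw [hα] at this
      exact_mod_cast this
    rw [← h1, mul_assoc]
    congr 1
    exact multinomial_mul_integral_monomial (n + 1)
      (by simp [Finset.sum_add_distrib, hα])
  have hI : ∀ k : Fin d → ℕ,
      Integrable (fun U => ‖∏ l, firstColumn U l ^ k l‖ ^ 2) (haarUnitary d) := fun k =>
    integrable_comp_firstColumn (F := fun v => ‖∏ l, v l ^ k l‖ ^ 2) (by fun_prop)
  have hsum : y α = ∑ j, y (α + Pi.single j 1) := by
    have h6 : ∀ e : Fin d → Fin d → ℕ, ∑ j, y (e j)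
        = ∫ U, ∑ j, ‖∏ l, firstColumn U l ^ e j l‖ ^ 2 ∂haarUnitary d := fun e =>
      (integral_finsetSum Finset.univ fun j _ => hI (e j)).symm
    rw [h6]
    refine integral_congr_ae (Filter.Eventually.of_forall fun U => ?_)
    simp only [prod_pow_add_single, norm_mul, mul_pow, ← Finset.sum_mul, sum_norm_sq_firstColumn,
      one_mul]
  have hn : ((n : ℝ) + 1) * Nat.multinomial Finset.univ α ≠ 0 := by positivity
  apply mul_left_cancel₀ hn
  have h5 : ((n : ℝ) + 1) * Nat.multinomial Finset.univ α * y α = (d + n) * M := by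
    rw [hsum, Finset.mul_sum]
    simp_rw [key]
    rw [← Finset.sum_mul, Finset.sum_add_distrib, ← Nat.cast_sum, hα]
    simp only [Finset.sum_const, Finset.card_univ, Fintype.card_fin, nsmul_eq_mul, mul_one]
    ring
  linear_combination (d + n : ℝ) * key i - (α i + 1 : ℝ) * h5

/-- Multiplication by a coordinate decreases the second moment of a homogeneous polynomial of
degree `n` by at most the factor `d + n`. -/
lemma integral_eval_le_coordinate_mul {n : ℕ} {h : MvPolynomial (Fin d) ℂ}
    (hh : h.IsHomogeneous n) (i : Fin d) :
    ∫ U, ‖MvPolynomial.eval (firstColumn U) h‖ ^ 2 ∂haarUnitary d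
      ≤ (d + n) * ∫ U, ‖firstColumn U i * MvPolynomial.eval (firstColumn U) h‖ ^ 2
          ∂haarUnitary d := by
  have h1 : ∀ U : Matrix.unitaryGroup (Fin d) ℂ,
      firstColumn U i * MvPolynomial.eval (firstColumn U) h
      = ∑ k ∈ h.support, h.coeff k * ∏ j, firstColumn U j ^ (⇑k + Pi.single i 1 : Fin d → ℕ) j := by
    intro U
    rw [MvPolynomial.eval_eq', Finset.mul_sum]
    refine Finset.sum_congr rfl fun k _ => ?_
    rw [prod_pow_add_single]; ring
  simp_rw [h1, MvPolynomial.eval_eq']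
  rw [integral_norm_sum_monomial_sq _ (fun k : Fin d →₀ ℕ => (k : Fin d → ℕ))
      (fun _ _ _ _ h => DFunLike.coe_injective h),
    integral_norm_sum_monomial_sq _ (fun k : Fin d →₀ ℕ => (k : Fin d → ℕ) + Pi.single i 1)
      (fun _ _ _ _ h => DFunLike.coe_injective (add_right_cancel h)), Finset.mul_sum]
  refine Finset.sum_le_sum fun k hk => ?_
  have hk' : ∑ j, k j = n := by
    by_contra hne
    rw [← Finsupp.degree_eq_sum] at hne
    exact MvPolynomial.mem_support_iff.mp hk (hh.coeff_eq_zero hne)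
  rw [mul_left_comm, integral_monomial_add_single hk' i]
  refine mul_le_mul_of_nonneg_left ?_ (by positivity)
  -- The only loss in the estimate: the factor `α i + 1` is replaced by `1`.
  refine le_mul_of_one_le_left (integral_nonneg fun U => by positivity) ?_
  simp

/-- The substitution `v ↦ W⁻¹ v` turns `φ` into a multiple of the coordinate `0`, while the other
forms still multiply to a homogeneous polynomial of degree `n`. -/
lemma integral_prod_linear_le_mul_linear {n : ℕ} (ψ : Fin n → Fin d → ℂ) (φ : Fin d → ℂ) :
    (∑ a, ‖φ a‖ ^ 2) * ∫ U, ∏ t, ‖∑ a, ψ t a * firstColumn U a‖ ^ 2 ∂haarUnitary d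
      ≤ (d + n) * ∫ U, (∏ t, ‖∑ a, ψ t a * firstColumn U a‖ ^ 2)
          * ‖∑ a, φ a * firstColumn U a‖ ^ 2 ∂haarUnitary d := by
  obtain ⟨W, hW⟩ := exists_unitary_row φ
  set V : Matrix.unitaryGroup (Fin d) ℂ := W⁻¹
  set h : MvPolynomial (Fin d) ℂ := ∏ t : Fin n, ∑ b, MvPolynomial.C
    (∑ a, ψ t a * (V : Matrix (Fin d) (Fin d) ℂ) a b) * MvPolynomial.X b
  have hh : h.IsHomogeneous n := by
    have := MvPolynomial.IsHomogeneous.prod Finset.univ (fun t : Fin n => ∑ b, MvPolynomial.C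
      (∑ a, ψ t a * (V : Matrix (Fin d) (Fin d) ℂ) a b) * MvPolynomial.X b) (fun _ => 1)
      fun t _ => MvPolynomial.IsHomogeneous.sum _ _ _ fun b _ =>
        MvPolynomial.isHomogeneous_C_mul_X _ b
    rwa [Finset.sum_const, Finset.card_univ, Fintype.card_fin, smul_eq_mul, mul_one] at this
  have heval : ∀ v : Fin d → ℂ, ∏ t, ‖∑ a, ψ t a
      * (V : Matrix (Fin d) (Fin d) ℂ).mulVec v a‖ ^ 2 = ‖MvPolynomial.eval v h‖ ^ 2 := by
    intro v
    simp only [h, map_prod, norm_prod, Finset.prod_pow, map_sum, map_mul, MvPolynomial.eval_C,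
      MvPolynomial.eval_X, Matrix.mulVec, dotProduct, Finset.mul_sum, Finset.sum_mul]
    congr 1
    refine Finset.prod_congr rfl fun t _ => ?_
    rw [Finset.sum_comm]
    simp_rw [mul_assoc]
  have hφ : ∀ v : Fin d → ℂ, ‖∑ a, φ a * (V : Matrix (Fin d) (Fin d) ℂ).mulVec v a‖ ^ 2
      = (∑ a, ‖φ a‖ ^ 2) * ‖v 0‖ ^ 2 := by
    intro v
    have hWV : (W : Matrix (Fin d) (Fin d) ℂ) * (V : Matrix (Fin d) (Fin d) ℂ) = 1 :=
      congrArg Subtype.val (mul_inv_cancel W)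
    rw [hW, Matrix.mulVec_mulVec, hWV, Matrix.one_mulVec, norm_mul, mul_pow, Complex.norm_real,
      Real.norm_of_nonneg (Real.sqrt_nonneg _),
      Real.sq_sqrt (Finset.sum_nonneg fun _ _ => by positivity)]
  rw [← integral_comp_mulVec_firstColumn (fun v => ∏ t, ‖∑ a, ψ t a * v a‖ ^ 2) V,
    ← integral_comp_mulVec_firstColumn
      (fun v => (∏ t, ‖∑ a, ψ t a * v a‖ ^ 2) * ‖∑ a, φ a * v a‖ ^ 2) V]
  simp_rw [heval, hφ, mul_left_comm _ (∑ a, ‖φ a‖ ^ 2) _]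
  rw [integral_const_mul, mul_left_comm]
  refine mul_le_mul_of_nonneg_left ?_ (Finset.sum_nonneg fun _ _ => by positivity)
  refine (integral_eval_le_coordinate_mul hh 0).trans_eq ?_
  simp_rw [norm_mul, mul_pow, mul_comm]

lemma prod_norm_sq_le_integral_prod_linear {n : ℕ} (ψ : Fin n → Fin d → ℂ) :
    (∏ t : Fin n, (d + (t : ℕ) : ℝ)⁻¹) * ∏ t, ∑ a, ‖ψ t a‖ ^ 2
      ≤ ∫ U, ∏ t, ‖∑ a, ψ t a * firstColumn U a‖ ^ 2 ∂haarUnitary d := by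
  induction n with
  | zero => simp
  | succ n ih =>
    have hd : (0 : ℝ) < d + n := by
      have : (0 : ℝ) < d := by exact_mod_cast Nat.pos_of_ne_zero (NeZero.ne d)
      positivity
    have h1 := ih fun t => ψ t.castSucc
    have h2 := integral_prod_linear_le_mul_linear (fun t => ψ t.castSucc) (ψ (Fin.last n))
    simp_rw [Fin.prod_univ_castSucc]
    simp only [Fin.val_castSucc, Fin.val_last]
    rw [mul_mul_mul_comm, mul_left_comm, ← div_eq_inv_mul]
    have h3 := mul_le_mul_of_nonneg_right h1
      (Finset.sum_nonneg fun a _ => sq_nonneg ‖ψ (Fin.last n) a‖ : 0 ≤ ∑ a, ‖ψ (Fin.last n) a‖ ^ 2)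
    refine le_of_mul_le_mul_left (le_trans ?_ h2) hd
    calc _ = _ := ?_
      _ ≤ _ := h3
      _ = _ := mul_comm _ _
    field_simp

/-- The average over a Haar random pure state of a product of `T` expectations of positive
operators `∑ j, |ψ_j⟩⟨ψ_j|` is at least the product of their traces over `d (d + 1) ⋯ (d + T - 1)`. -/
lemma prod_trace_le_integral_prod_sum {T : ℕ} {J : Fin T → Type*} [∀ t, Fintype (J t)]
    (ψ : (t : Fin T) → J t → Fin d → ℂ) :
    (∏ t : Fin T, (d + (t : ℕ) : ℝ)⁻¹) * ∏ t, ∑ j, ∑ a, ‖ψ t j a‖ ^ 2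
      ≤ ∫ U, ∏ t, ∑ j, ‖∑ a, ψ t j a * firstColumn U a‖ ^ 2 ∂haarUnitary d := by
  classical
  -- Expanding the product of sums over choice functions reduces the claim to one linear form per
  -- round.
  have h1 : ∀ f : (t : Fin T) → J t → ℝ,
      ∏ t, ∑ j, f t j = ∑ x : (t : Fin T) → J t, ∏ t, f t (x t) := fun f => by
    rw [Finset.prod_univ_sum, Fintype.piFinset_univ]
  rw [h1 fun t j => ∑ a, ‖ψ t j a‖ ^ 2]
  simp_rw [fun U => h1 fun t j => ‖∑ a, ψ t j a * firstColumn U a‖ ^ 2]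
  rw [integral_finsetSum _ fun f _ => integrable_comp_firstColumn
    (F := fun v => ∏ t, ‖∑ a, ψ t (f t) a * v a‖ ^ 2) (by fun_prop), Finset.mul_sum]
  exact Finset.sum_le_sum fun f _ => prod_norm_sq_le_integral_prod_linear fun t => ψ t (f t)

end Moments

/-! ### Distributions on decision trees and one-sided likelihood ratios. -/

lemma hasSum_mul_conditional {A B : Type*} {f : A → ℝ} {g : A → B → ℝ} (hf0 : ∀ a, 0 ≤ f a)
    (hg0 : ∀ a b, 0 ≤ g a b) (hf : HasSum f 1) (hg : ∀ a, HasSum (g a) 1) :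
    HasSum (fun x : A × B => f x.1 * g x.1 x.2) 1 := by
  have h1 : ∀ a, HasSum (fun b => f a * g a b) (f a) := fun a => by
    simpa using (hg a).mul_left (f a)
  have hs : Summable fun x : A × B => f x.1 * g x.1 x.2 := by
    rw [summable_prod_of_nonneg fun x => mul_nonneg (hf0 _) (hg0 _ _)]
    refine ⟨fun a => (h1 a).summable, ?_⟩
    simp_rw [fun a => (h1 a).tsum_eq]
    exact hf.summable
  have h2 := hs.hasSum.prod_fiberwise h1
  rw [← h2.unique hf]
  exact hs.hasSum

/-- The probabilities of the leaves of a decision tree add up to one. -/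
lemma hasSum_prod_conditional {K : Type*} : ∀ {T : ℕ} (p : (t : Fin T) → (Fin t → K) → K → ℝ),
    (∀ t h k, 0 ≤ p t h k) → (∀ t h, HasSum (p t h) 1) →
    HasSum (fun l : Fin T → K => ∏ t : Fin T, p t (fun i => l (Fin.castLE t.isLt.le i)) (l t)) 1
  | 0, p, _, _ => by simp
  | T + 1, p, h0, h1 => by
    have ih := hasSum_prod_conditional (T := T) (fun t => p t.castSucc) (fun t => h0 t.castSucc)
      fun t => h1 t.castSucc
    have h2 := hasSum_mul_conditional (A := Fin T → K) (g := fun l k => p (Fin.last T) l k)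
      (fun l => Finset.prod_nonneg fun t _ => h0 _ _ _) (h0 (Fin.last T)) ih (h1 (Fin.last T))
    rw [← (Fin.snocEquiv fun _ => K).hasSum_iff]
    rw [← (Equiv.prodComm K (Fin T → K)).hasSum_iff] at h2
    convert h2 using 1
    ext ⟨k, l⟩
    have hl : (fun i => (Fin.snoc l k : Fin (T + 1) → K) (Fin.castLE (Fin.last T).isLt.le i)) = l :=
      funext fun i => Fin.snoc_castSucc (α := fun _ => K) k l i
    simp only [Function.comp_apply, Fin.snocEquiv_apply, Equiv.prodComm_apply, Prod.swap_prod_mk]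
    rw [Fin.prod_univ_castSucc]
    congr 1
    · refine Finset.prod_congr rfl fun t _ => ?_
      have ht : (fun i => (Fin.snoc l k : Fin (T + 1) → K) (Fin.castLE t.castSucc.isLt.le i))
          = fun i => l (Fin.castLE t.isLt.le i) :=
        funext fun i => Fin.snoc_castSucc (α := fun _ => K) k l (Fin.castLE t.isLt.le i)
      exact congrArg₂ _ ht (Fin.snoc_castSucc (α := fun _ => K) k l t)
    · exact congrArg₂ _ hl (Fin.snoc_last (α := fun _ => K) k l)

/-- A lower bound on `p` suffices for both signs because `p` and `q` have equal total mass: `p - q +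
ε q` is nonnegative with sum `ε`, so weighting it by `1 - a` bounds the excess of `p` as well. -/
lemma abs_tsum_mul_sub_tsum_mul_le {L : Type*} {p q a : L → ℝ} {ε : ℝ} (hp0 : ∀ l, 0 ≤ p l)
    (hq0 : ∀ l, 0 ≤ q l) (hε : 0 ≤ ε) (hp : HasSum p 1) (hq : HasSum q 1)
    (ha : ∀ l, a l ∈ Set.Icc (0 : ℝ) 1) (hpq : ∀ l, (1 - ε) * q l ≤ p l) :
    |∑' l, p l * a l - ∑' l, q l * a l| ≤ ε := by
  have hpa : Summable fun l => p l * a l := hp.summable.of_nonneg_of_le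
    (fun l => mul_nonneg (hp0 l) (ha l).1) fun l => mul_le_of_le_one_right (hp0 l) (ha l).2
  have hqa : Summable fun l => q l * a l := hq.summable.of_nonneg_of_le
    (fun l => mul_nonneg (hq0 l) (ha l).1) fun l => mul_le_of_le_one_right (hq0 l) (ha l).2
  have hd := hpa.hasSum.sub hqa.hasSum
  have hεq : HasSum (fun l => ε * q l) ε := by simpa using hq.mul_left ε
  have hpq' : HasSum (fun l => p l - q l + ε * q l) ε := by simpa using (hp.sub hq).add hεq
  have hnn : ∀ l, 0 ≤ p l - q l + ε * q l := fun l => by linarith [hpq l]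
  rw [abs_le]
  constructor
  · refine hasSum_le (fun l => ?_) hεq.neg hd
    have h1 := mul_nonneg (hnn l) (ha l).1
    have h2 := mul_nonneg (mul_nonneg hε (hq0 l)) (sub_nonneg.mpr (ha l).2)
    linarith
  · refine hasSum_le (fun l => ?_) hd hpq'
    have h1 := mul_nonneg (hnn l) (sub_nonneg.mpr (ha l).2)
    have h2 := mul_nonneg (mul_nonneg hε (hq0 l)) (ha l).1
    linarith

/-! ### Outcome probabilities under the Born rule. -/

section Born

variable {K ι : Type*} [Fintype ι] [DecidableEq ι]

lemma trace_mul_posSemidef_nonneg {ι : Type*} [Fintype ι] {ρ E : Matrix ι ι ℂ} (hρ : ρ.PosSemidef) (hE : E.PosSemidef) :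
    0 ≤ (Matrix.trace (ρ * E)).re := by
  obtain ⟨m, v, rfl⟩ := Matrix.posSemidef_iff_eq_sum_vecMulVec.mp hE
  rw [Matrix.mul_sum, Matrix.trace_sum, Complex.re_sum]
  refine Finset.sum_nonneg fun i _ => ?_
  rw [Matrix.mul_vecMulVec, Matrix.trace_vecMulVec, dotProduct_comm]
  exact (Complex.le_def.mp (hρ.dotProduct_mulVec_nonneg (v i))).1

lemma POVM.prob_nonneg (M : POVM K ι) {ρ : Matrix ι ι ℂ} (hρ : ρ.PosSemidef) (k : K) :
    0 ≤ M.prob ρ k := trace_mul_posSemidef_nonneg hρ (M.posSemidef k)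

lemma POVM.hasSum_prob (M : POVM K ι) {ρ : Matrix ι ι ℂ} (hρ : ρ.trace = 1) :
    HasSum (M.prob ρ) 1 := by
  have hc : Continuous fun E : Matrix ι ι ℂ => (Matrix.trace (ρ * E)).re :=
    Complex.continuous_re.comp (continuous_const.matrix_mul continuous_id).matrix_trace
  let φ : Matrix ι ι ℂ →+ ℝ :=
    { toFun := fun E => (Matrix.trace (ρ * E)).re
      map_zero' := by simp
      map_add' := fun x y => by simp [Matrix.mul_add] }
  have := M.hasSum_one.map φ hc
  simpa [φ, hρ, Function.comp_def, funext_iff, show M.prob ρ = fun k => (ρ * M.E k).trace.re from rfl]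
    using this

variable {T : ℕ} (A : Algorithm K ι T) {ρ : Matrix ι ι ℂ}

lemma Algorithm.outcomeProb_nonneg (hρ : ρ.PosSemidef) (l : Fin T → K) :
    0 ≤ A.outcomeProb ρ l :=
  Finset.prod_nonneg fun _ _ => POVM.prob_nonneg _ hρ _

lemma Algorithm.hasSum_outcomeProb (hρ : ρ.PosSemidef) (hρ1 : ρ.trace = 1) :
    HasSum (A.outcomeProb ρ) 1 :=
  hasSum_prod_conditional (fun t h => (A.povm t h).prob ρ)
    (fun _ _ _ => POVM.prob_nonneg _ hρ _) fun _ _ => POVM.hasSum_prob _ hρ1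

lemma Algorithm.outcomeProb_le_one (hρ : ρ.PosSemidef) (hρ1 : ρ.trace = 1) (l : Fin T → K) :
    A.outcomeProb ρ l ≤ 1 :=
  le_hasSum (A.hasSum_outcomeProb hρ hρ1) l fun l' _ => A.outcomeProb_nonneg hρ l'

end Born

/-! ### Product states against the maximally mixed state. -/

section States

variable {d : ℕ} [NeZero d]

/-- The tensor product of two vectors. -/
def tensorVec (x y : Fin d → ℂ) : Fin d × Fin d → ℂ := fun p => x p.1 * y p.2

lemma pureState_eq_vecMulVec (U : Matrix.unitaryGroup (Fin d) ℂ) :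
    pureState U = Matrix.vecMulVec (firstColumn U) (star (firstColumn U)) := by
  ext a b
  simp [pureState, Matrix.mul_apply, Matrix.single_apply, Matrix.vecMulVec_apply, firstColumn,
    Finset.sum_ite_eq, ite_and]

lemma pureState_kronecker (V W : Matrix.unitaryGroup (Fin d) ℂ) :
    pureState V ⊗ₖ pureState W = Matrix.vecMulVec (tensorVec (firstColumn V) (firstColumn W))
      (star (tensorVec (firstColumn V) (firstColumn W))) := by
  ext ⟨a, b⟩ ⟨a', b'⟩
  simp [pureState_eq_vecMulVec, Matrix.vecMulVec_apply, tensorVec]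
  ring

lemma posSemidef_pureState_kronecker (V W : Matrix.unitaryGroup (Fin d) ℂ) :
    (pureState V ⊗ₖ pureState W).PosSemidef := by
  rw [pureState_kronecker]
  exact Matrix.posSemidef_vecMulVec_self_star _

lemma trace_pureState (U : Matrix.unitaryGroup (Fin d) ℂ) : (pureState U).trace = 1 := by
  have h : star (U : Matrix (Fin d) (Fin d) ℂ) * (U : Matrix (Fin d) (Fin d) ℂ) = 1 :=
    Matrix.mem_unitaryGroup_iff'.mp U.2
  rw [pureState, Matrix.trace_mul_cycle, h, one_mul, Matrix.trace_single_eq_same]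

lemma trace_pureState_kronecker (V W : Matrix.unitaryGroup (Fin d) ℂ) :
    (pureState V ⊗ₖ pureState W).trace = 1 := by
  rw [Matrix.trace_kronecker, trace_pureState, trace_pureState, one_mul]

lemma posSemidef_maxMixed {d : ℕ} : (maxMixed d).PosSemidef := by
  refine Matrix.PosSemidef.one.smul ?_
  rw [← Complex.ofReal_natCast, ← Complex.ofReal_pow, ← Complex.ofReal_inv, Complex.zero_le_real]
  positivity

lemma trace_maxMixed : (maxMixed d).trace = 1 := by
  have : (d : ℂ) ≠ 0 := by exact_mod_cast NeZero.ne d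
  simp [maxMixed, Matrix.trace_smul]
  field_simp

lemma POVM.prob_maxMixed {K : Type*} {d : ℕ} (M : POVM K (Fin d × Fin d)) {k : K} {m : ℕ}
    {v : Fin m → Fin d × Fin d → ℂ} (hv : M.E k = ∑ j, Matrix.vecMulVec (v j) (star (v j))) :
    M.prob (maxMixed d) k = ((d : ℝ) ^ 2)⁻¹ * ∑ j, ∑ p, ‖v j p‖ ^ 2 := by
  have h1 : (M.E k).trace = ((∑ j, ∑ p, ‖v j p‖ ^ 2 : ℝ) : ℂ) := by
    rw [hv, Matrix.trace_sum]; push_cast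
    refine Finset.sum_congr rfl fun j _ => ?_
    rw [Matrix.trace_vecMulVec]
    refine Finset.sum_congr rfl fun p _ => ?_
    simp [Complex.mul_conj']
  rw [POVM.prob, maxMixed, smul_mul_assoc, one_mul, Matrix.trace_smul, h1, smul_eq_mul,
    ← Complex.ofReal_natCast, ← Complex.ofReal_pow, ← Complex.ofReal_inv, ← Complex.ofReal_mul,
    Complex.ofReal_re]

lemma POVM.prob_pureState_kronecker {K : Type*} (M : POVM K (Fin d × Fin d)) {k : K} {m : ℕ}
    {v : Fin m → Fin d × Fin d → ℂ} (hv : M.E k = ∑ j, Matrix.vecMulVec (v j) (star (v j)))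
    (V W : Matrix.unitaryGroup (Fin d) ℂ) :
    M.prob (pureState V ⊗ₖ pureState W) k
      = ∑ j, ‖∑ b, (∑ a, star (v j (a, b)) * firstColumn V a) * firstColumn W b‖ ^ 2 := by
  rw [POVM.prob, pureState_kronecker, hv, Matrix.mul_sum, Matrix.trace_sum, Complex.re_sum]
  refine Finset.sum_congr rfl fun j _ => ?_
  set x := tensorVec (firstColumn V) (firstColumn W) with hx
  have h1 : ∑ b, (∑ a, star (v j (a, b)) * firstColumn V a) * firstColumn W b
      = star (v j) ⬝ᵥ x := by
    simp only [dotProduct, Fintype.sum_prod_type_right, Finset.sum_mul, hx, tensorVec, mul_assoc,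
      Pi.star_apply]
  have h2 : star x ⬝ᵥ v j = star (star (v j) ⬝ᵥ x) := by
    rw [Matrix.star_dotProduct]
  rw [h1, Matrix.vecMulVec_mul_vecMulVec, Matrix.trace_vecMulVec, dotProduct_smul, h2,
    dotProduct_comm x, smul_eq_mul, Complex.star_def, Complex.conj_mul']
  norm_cast

lemma measurable_prob_pureState_kronecker {K : Type*} (M : POVM K (Fin d × Fin d)) (k : K) :
    Measurable fun VW : Matrix.unitaryGroup (Fin d) ℂ × Matrix.unitaryGroup (Fin d) ℂ =>
      M.prob (pureState VW.1 ⊗ₖ pureState VW.2) k := by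
  obtain ⟨m, v, hv⟩ := Matrix.posSemidef_iff_eq_sum_vecMulVec.mp (M.posSemidef k)
  simp_rw [M.prob_pureState_kronecker hv]
  have hz : ∀ a, Measurable fun U : Matrix.unitaryGroup (Fin d) ℂ => firstColumn U a := fun a =>
    ((continuous_apply a).comp continuous_firstColumn).measurable
  have hz1 : ∀ a, Measurable fun VW : Matrix.unitaryGroup (Fin d) ℂ × Matrix.unitaryGroup (Fin d) ℂ =>
    firstColumn VW.1 a := fun a => (hz a).comp measurable_fst
  have hz2 : ∀ a, Measurable fun VW : Matrix.unitaryGroup (Fin d) ℂ × Matrix.unitaryGroup (Fin d) ℂ =>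
    firstColumn VW.2 a := fun a => (hz a).comp measurable_snd
  fun_prop

variable {K : Type*} {T : ℕ} (A : Algorithm K (Fin d × Fin d) T)

lemma Algorithm.integrable_outcomeProb (l : Fin T → K) :
    Integrable (fun VW => A.outcomeProb (pureState VW.1 ⊗ₖ pureState VW.2) l)
      ((haarUnitary d).prod (haarUnitary d)) := by
  refine Integrable.of_bound (C := 1) (Finset.measurable_prod _ fun t _ =>
    measurable_prob_pureState_kronecker _ _).aestronglyMeasurable
    (Filter.Eventually.of_forall fun VW => ?_)
  rw [Real.norm_of_nonneg (A.outcomeProb_nonneg (posSemidef_pureState_kronecker _ _) l)]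
  exact A.outcomeProb_le_one (posSemidef_pureState_kronecker _ _) (trace_pureState_kronecker _ _) l

/-- The probability of an outcome string, averaged over Haar random product states. -/
noncomputable def Algorithm.meanOutcomeProb (l : Fin T → K) : ℝ :=
  ∫ VW, A.outcomeProb (pureState VW.1 ⊗ₖ pureState VW.2) l ∂((haarUnitary d).prod (haarUnitary d))

lemma Algorithm.meanOutcomeProb_nonneg (l : Fin T → K) : 0 ≤ A.meanOutcomeProb l :=
  integral_nonneg fun _ => A.outcomeProb_nonneg (posSemidef_pureState_kronecker _ _) l

/-- Sum and integral may be exchanged since, for each product state, the terms are nonnegative with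
partial sums at most `1`. A general weight `a` serves both total mass (`a = 1`) and acceptance. -/
lemma Algorithm.hasSum_integral_outcomeProb_mul [Countable K] {a : (Fin T → K) → ℝ}
    (ha : ∀ l, a l ∈ Set.Icc (0 : ℝ) 1) :
    HasSum (fun l => A.meanOutcomeProb l * a l)
      (∫ VW, ∑' l, A.outcomeProb (pureState VW.1 ⊗ₖ pureState VW.2) l * a l
        ∂((haarUnitary d).prod (haarUnitary d))) := by
  have h := hasSum_integral_of_summable_integral_norm
    (F := fun l VW => A.outcomeProb (pureState VW.1 ⊗ₖ pureState VW.2) l * a l)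
    (μ := (haarUnitary d).prod (haarUnitary d))
    (fun l => (A.integrable_outcomeProb l).mul_const _) ?_
  · simp only [integral_mul_const] at h
    exact h
  have hnn := fun VW : Matrix.unitaryGroup (Fin d) ℂ × Matrix.unitaryGroup (Fin d) ℂ =>
    A.outcomeProb_nonneg (posSemidef_pureState_kronecker VW.1 VW.2)
  have hsum := fun VW : Matrix.unitaryGroup (Fin d) ℂ × Matrix.unitaryGroup (Fin d) ℂ =>
    A.hasSum_outcomeProb (posSemidef_pureState_kronecker VW.1 VW.2)
      (trace_pureState_kronecker VW.1 VW.2)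
  refine summable_of_sum_le (c := 1) (fun l => integral_nonneg fun _ => norm_nonneg _) fun s => ?_
  rw [← integral_finsetSum _ fun l _ => ((A.integrable_outcomeProb l).mul_const _).norm]
  calc _ ≤ ∫ _, (1 : ℝ) ∂((haarUnitary d).prod (haarUnitary d)) := by
        refine integral_mono (integrable_finsetSum _ fun l _ =>
          ((A.integrable_outcomeProb l).mul_const _).norm) (integrable_const _) fun VW => ?_
        refine le_trans (Finset.sum_le_sum fun l _ => ?_)
          (sum_le_hasSum s (fun l _ => hnn VW l) (hsum VW))
        rw [Real.norm_of_nonneg (mul_nonneg (hnn VW l) (ha l).1)]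
        exact mul_le_of_le_one_right (hnn VW l) (ha l).2
    _ = 1 := by simp

lemma Algorithm.hasSum_meanOutcomeProb [Countable K] : HasSum A.meanOutcomeProb 1 := by
  have h := A.hasSum_integral_outcomeProb_mul (a := fun _ => 1) (by simp)
  have h1 : ∀ VW : Matrix.unitaryGroup (Fin d) ℂ × Matrix.unitaryGroup (Fin d) ℂ,
      ∑' l, A.outcomeProb (pureState VW.1 ⊗ₖ pureState VW.2) l = 1 := fun VW =>
    (A.hasSum_outcomeProb (posSemidef_pureState_kronecker VW.1 VW.2)
      (trace_pureState_kronecker VW.1 VW.2)).tsum_eq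
  simpa [h1] using h

lemma Algorithm.acceptProbProduct_eq_tsum [Countable K] :
    A.acceptProbProduct = ∑' l, A.meanOutcomeProb l * A.accept l :=
  (A.hasSum_integral_outcomeProb_mul A.accept_mem).tsum_eq.symm

/-- Every outcome string is nearly as likely for a random product state as for the maximally
mixed state. -/
lemma Algorithm.mul_outcomeProb_maxMixed_le (l : Fin T → K) :
    (∏ t : Fin T, (d / (d + (t : ℕ)) : ℝ)) ^ 2 * A.outcomeProb (maxMixed d) l
      ≤ A.meanOutcomeProb l := by
  have hd : (d : ℝ) ≠ 0 := by exact_mod_cast NeZero.ne d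
  set M := fun t : Fin T => A.povm t fun i => l (Fin.castLE t.isLt.le i)
  choose m v hv using fun t =>
    Matrix.posSemidef_iff_eq_sum_vecMulVec.mp ((M t).posSemidef (l t))
  set κ : ℝ := ∏ t : Fin T, (d + (t : ℕ) : ℝ)⁻¹ with hκ
  have hκ0 : 0 ≤ κ := Finset.prod_nonneg fun t _ => by positivity
  have hint := A.integrable_outcomeProb l
  rw [Algorithm.meanOutcomeProb, integral_prod _ hint]
  -- For fixed `V`, contracting each rank-one term with the first vector leaves linear forms in the
  -- second. Their squared norms, summed over `b`, are again sums of squared linear forms in the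
  -- first vector, now indexed by pairs `(j, b)`, so the same bound applies once more.
  have hin : ∀ V, κ * ∏ t, ∑ jb : Fin (m t) × Fin d,
      ‖∑ a, star (v t jb.1 (a, jb.2)) * firstColumn V a‖ ^ 2
      ≤ ∫ W, A.outcomeProb (pureState V ⊗ₖ pureState W) l ∂haarUnitary d := by
    intro V
    refine le_trans (le_of_eq ?_) ((prod_trace_le_integral_prod_sum fun t j b =>
      ∑ a, star (v t j (a, b)) * firstColumn V a).trans_eq ?_)
    · simp_rw [Fintype.sum_prod_type, hκ]
    · refine integral_congr_ae (Filter.Eventually.of_forall fun W => ?_)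
      exact Finset.prod_congr rfl fun t _ => ((M t).prob_pureState_kronecker (hv t) V W).symm
  have hout := prod_trace_le_integral_prod_sum (d := d)
    fun t (jb : Fin (m t) × Fin d) a => star (v t jb.1 (a, jb.2))
  calc _ = κ * (κ * ∏ t, ∑ jb : Fin (m t) × Fin d, ∑ a, ‖star (v t jb.1 (a, jb.2))‖ ^ 2) := by
        rw [← mul_assoc, ← sq, hκ, ← Finset.prod_pow, ← Finset.prod_pow,
          Algorithm.outcomeProb, ← Finset.prod_mul_distrib, ← Finset.prod_mul_distrib]
        refine Finset.prod_congr rfl fun t _ => ?_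
        rw [(M t).prob_maxMixed (hv t)]
        have hs : ∑ jb : Fin (m t) × Fin d, ∑ a, ‖star (v t jb.1 (a, jb.2))‖ ^ 2
            = ∑ j, ∑ p, ‖v t j p‖ ^ 2 := by
          rw [Fintype.sum_prod_type]
          refine Finset.sum_congr rfl fun j _ => ?_
          rw [Fintype.sum_prod_type_right]
          simp_rw [norm_star]
        rw [hs]
        field_simp
    _ ≤ κ * ∫ V, ∏ t, ∑ jb : Fin (m t) × Fin d,
          ‖∑ a, star (v t jb.1 (a, jb.2)) * firstColumn V a‖ ^ 2 ∂haarUnitary d :=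
        mul_le_mul_of_nonneg_left hout hκ0
    _ = ∫ V, κ * ∏ t, ∑ jb : Fin (m t) × Fin d,
          ‖∑ a, star (v t jb.1 (a, jb.2)) * firstColumn V a‖ ^ 2 ∂haarUnitary d :=
        (integral_const_mul _ _).symm
    _ ≤ _ := integral_mono (integrable_comp_firstColumn (F := fun x => κ * ∏ t,
          ∑ jb : Fin (m t) × Fin d, ‖∑ a, star (v t jb.1 (a, jb.2)) * x a‖ ^ 2) (by fun_prop))
        hint.integral_prod_left hin

lemma one_sub_sum_le_prod_one_sub {n : ℕ} {x : ℕ → ℝ} (hx : ∀ t, x t ∈ Set.Icc (0 : ℝ) 1) :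
    1 - ∑ t ∈ Finset.range n, x t ≤ ∏ t ∈ Finset.range n, (1 - x t) := by
  induction n with
  | zero => simp
  | succ n ih =>
    rw [Finset.sum_range_succ, Finset.prod_range_succ]
    have h1 : ∏ t ∈ Finset.range n, (1 - x t) ≤ 1 :=
      Finset.prod_le_one (fun t _ => by linarith [(hx t).2]) fun t _ => by linarith [(hx t).1]
    nlinarith [mul_le_mul_of_nonneg_right h1 (hx n).1]

lemma one_sub_sq_div_le_prod_sq (d T : ℕ) [NeZero d] :
    1 - (T : ℝ) ^ 2 / d ≤ (∏ t : Fin T, (d / (d + (t : ℕ)) : ℝ)) ^ 2 := by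
  have hd : (0 : ℝ) < d := by exact_mod_cast Nat.pos_of_ne_zero (NeZero.ne d)
  have h1 := one_sub_sum_le_prod_one_sub (n := T) (x := fun t => (t : ℝ) / (d + t)) fun t =>
    ⟨by positivity, div_le_one_of_le₀ (by linarith) (by positivity)⟩
  have h2 : ∏ t : Fin T, (d / (d + (t : ℕ)) : ℝ)
      = ∏ t ∈ Finset.range T, (1 - (t : ℝ) / (d + t)) := by
    rw [Finset.prod_range]
    refine Finset.prod_congr rfl fun t _ => ?_
    have : (d + (t : ℕ) : ℝ) ≠ 0 := by positivity
    field_simp; ring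
  have h3 : ∑ t ∈ Finset.range T, (t : ℝ) / (d + t) ≤ (T : ℝ) ^ 2 / d / 2 := by
    have h4 : (∑ t ∈ Finset.range T, (t : ℝ)) * 2 ≤ (T : ℝ) ^ 2 := by
      have := Finset.sum_range_id_mul_two T
      have h5 : (∑ t ∈ Finset.range T, t) * 2 ≤ T ^ 2 := by
        rw [this, sq]; exact Nat.mul_le_mul_left _ (Nat.sub_le _ _)
      rw [← Nat.cast_sum]; exact_mod_cast h5
    calc _ ≤ ∑ t ∈ Finset.range T, (t : ℝ) / d := by
          refine Finset.sum_le_sum fun t _ => ?_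
          gcongr
          linarith [(Nat.cast_nonneg t : (0 : ℝ) ≤ t)]
      _ = (∑ t ∈ Finset.range T, (t : ℝ)) * 2 / d / 2 := by rw [← Finset.sum_div]; ring
      _ ≤ _ := by gcongr
  rw [h2]
  -- The product `x` is at least `1 - T² / (2d)`, and `x² ≥ 2x - 1` doubles the loss to `T² / d`.
  nlinarith [sq_nonneg (∏ t ∈ Finset.range T, (1 - (t : ℝ) / (d + t)) - 1)]

lemma Algorithm.bias_le [Countable K] : A.bias ≤ (T : ℝ) ^ 2 / d := by
  rw [Algorithm.bias, A.acceptProbProduct_eq_tsum, Algorithm.acceptProb]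
  refine abs_tsum_mul_sub_tsum_mul_le A.meanOutcomeProb_nonneg
    (A.outcomeProb_nonneg posSemidef_maxMixed) (by positivity) A.hasSum_meanOutcomeProb
    (A.hasSum_outcomeProb posSemidef_maxMixed trace_maxMixed) A.accept_mem fun l => ?_
  exact (mul_le_mul_of_nonneg_right (one_sub_sq_div_le_prod_sq d T)
    (A.outcomeProb_nonneg posSemidef_maxMixed l)).trans (A.mul_outcomeProb_maxMixed_le l)

end States

end SingleCopy

theorem proposition8 :
    ∃ C : ℝ, 0 < C ∧ ∃ c : ℝ, 0 < c ∧
      ∀ (d : ℕ) [NeZero d] (T : ℕ) (K : Type*) [Countable K]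
        (A : SingleCopy.Algorithm K (Fin d × Fin d) T),
        A.bias ≤ C * ((T : ℝ) ^ 2 / (d : ℝ)) ∧
        (2 / 3 ≤ A.successProb → c * Real.sqrt d ≤ (T : ℝ)) := by
  -- Success probability is `1/2` plus half the signed bias, so `2/3` forces bias at least `1/3` and
  -- `T² ≥ d / 3`. Any positive `c` with `c² ≤ 1/3` would do; `1/2` is a convenient one.
  refine ⟨1, one_pos, 1 / 2, by norm_num, fun d _ T K _ A => ⟨by simpa using A.bias_le, fun h => ?_⟩⟩
  have hd : (0 : ℝ) < d := by exact_mod_cast Nat.pos_of_ne_zero (NeZero.ne d)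
  have h1 : 1 / 3 ≤ (T : ℝ) ^ 2 / d := by
    refine le_trans ?_ (A.bias_le)
    refine le_trans ?_ (le_abs_self _)
    rw [SingleCopy.Algorithm.successProb] at h
    linarith
  rw [le_div_iff₀ hd] at h1
  refine abs_le_of_sq_le_sq' ?_ (Nat.cast_nonneg T) |>.2
  rw [mul_pow, Real.sq_sqrt hd.le]
  linarith
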